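/- **Definitions.** A *reproducing kernel* on a set $X$ is a symmetric $K:X\times X\to\mathbb R$ with $\sum_{i,j}\alpha_i\alpha_jK(x_i,x_j)\ge 0$ for all finite families $x_i\in X$, $\alpha_i\in\mathbb R$; $\mathcal H(K)$ is its reproducing kernel Hilbert space and $k_x=K(x,\cdot)$ are its generators. For $S\subset X$ let $K_S=K|_{S\times S}$ and, for $u\in X$, let $k_{u,S}=K(u,\cdot)|_S\in\mathcal H(K_S)$. Given a symmetric $\Omega\subset X\times X$ containing the diagonal, $S\subset X$ *separates* $x,y\in X\setminus S$ in $\Omega$ if every finite path $x=z_0,z_1,\dots,z_{n+1}=y$ with all $(z_k,z_{k+1})\in\Omega$ has $z_k\in S$ for some $1\le k\le n$. A *canonical completion* of $K_\Omega:\Omega\to\mathbb R$ is a reproducing kernel $\tilde K$ on $X$ with $\tilde K|_\Omega=K_\Omega$ and $\tilde K(x,y)=\langle\tilde k_{x,S},\tilde k_{y,S}\rangle_{\mathcal H(\tilde K_S)}$ whenever $S$ separates $x$ and $y$ in $\Omega$. Let $a>0$ and let $F:[-a,a]\to\mathbb R$ be a continuous positive-definite function, i.e. $F(-t)=F(t)$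 and $\sum_{i,j}\alpha_i\alpha_jF(x_i-x_j)\ge0$ for all finite families of reals $x_i$ with all $|x_i-x_j|\le a$ and all $\alpha_i\in\mathbb R$. A function $\tilde F:\mathbb R\to\mathbb R$ is a *canonical extension* of $F$ if $\tilde K(x,y)=\tilde F(x-y)$ is a canonical completion, on $X=\mathbb R$, of $K_\Omega(x,y)=F(x-y)$, $\Omega=\{(x,y)\in\mathbb R^2:|x-y|\le a\}$. Let $K(x,y)=F(x-y)$ on $[0,a]$ and $\mathcal H=\mathcal H(K)$, with generators $k_u$. For $t\in\mathbb R$ let $I_t=[t,t+a]$, let $\mathcal H_t$ be the reproducing kernel Hilbert space of $F(x-y)$ on $I_t$, with generators $k_{u,I_t}$, $u\in I_t$, and let $T_t:\mathcal H\to\mathcal H_t$ be the isometry $T_tg(u)=g(u-t)$. **Theorem.** 1. (Canonical semigroup.) Let $\tilde F$ be a canonical extension of $F$. For all $s,t\in\mathbb R$ there is a unique bounded linear map $\Phi_{st}:\mathcal H_t\to\mathcal H_s$ sending $k_{u,I_t}$ to the function $w\mapsto\tilde F(u-w)$ on $I_s$, for every $u\in I_t$; it is a contraction. For $s\ge t$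 and $h\in\mathbb R$, $$T_s^*\Phi_{st}T_t=T_{s+h}^*\Phi_{s+h,t+h}T_{t+h}.$$ The operators $\Phi_s:=T_s^*\Phi_{s0}$ $(s\ge0)$, where $\mathcal H_0=\mathcal H$, form a strongly continuous semigroup of contractions on $\mathcal H$ (that is, $\Phi_0=I$, $\Phi_s\Phi_t=\Phi_{s+t}$, $\|\Phi_s\|\le1$ and $\lim_{h\to0^+}\|\Phi_hg-g\|=0$ for every $g\in\mathcal H$) with $$\Phi_tk_u=k_{u-t}\quad\text{for }0\le t\le u\le a,\qquad(\ast)$$ and $\tilde F(t)=\langle k_0,\Phi_{|t|}k_0\rangle$ for all $t\in\mathbb R$. 2. (Correspondence.) The map sending $\{\Phi_t\}_{t\ge0}$ to the function $$\tilde F(t)=\langle k_0,\Phi_{|t|}k_0\rangle\qquad(t\in\mathbb R)$$ is a bijection from the set of all strongly continuous semigroups of contractions on $\mathcal H$ satisfying $(\ast)$ onto the set of all canonical extensions of $F$. Its inverse is the construction in part 1. -/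

import Mathlib

open Set Filter Topology
open scoped NNReal InnerProductSpace

noncomputable section

/-- A (real) reproducing kernel on a set `X`: a symmetric function `X × X → ℝ` all of whose finite
quadratic forms are non-negative. -/
structure ReproducingKernel (X : Type*) where
  toFun : X → X → ℝ
  symm' : ∀ x y, toFun x y = toFun y x
  nonneg' : ∀ (n : ℕ) (α : Fin n → ℝ) (x : Fin n → X),
    0 ≤ ∑ i, ∑ j, α i * α j * toFun (x i) (x j)

namespace ReproducingKernel

instance instCoeFunReproducingKernel {X : Type*} :
    CoeFun (ReproducingKernel X) (fun _ => X → X → ℝ) :=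
  ⟨ReproducingKernel.toFun⟩

/-- The kernel as a matrix of operators on the one-dimensional space `ℝ`, which is the form in
which Mathlib's theory of reproducing kernel Hilbert spaces takes it. -/
def toMatrix {X : Type*} (K : ReproducingKernel X) : Matrix X X (ℝ →L[ℝ] ℝ) :=
  Matrix.of fun x y => K x y • ContinuousLinearMap.id ℝ ℝ

theorem toMatrix_apply {X : Type*} (K : ReproducingKernel X) (x y : X) (r : ℝ) :
    K.toMatrix x y r = K x y * r := by
  simp [toMatrix]

open scoped ComplexOrder in
theorem posSemidef_toMatrix {X : Type*} (K : ReproducingKernel X) : K.toMatrix.PosSemidef := by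
  refine ((RKHS.posSemidef_tfae (K := K.toMatrix)).out 0 2 :
    K.toMatrix.PosSemidef ↔ K.toMatrix.IsHermitian ∧ ∀ vv : X →₀ ℝ,
      0 ≤ RCLike.re (vv.sum fun x w => vv.sum fun x' w' => ⟪K.toMatrix x' x w, w'⟫_ℝ)).mpr
    ⟨?_, fun vv => ?_⟩
  · ext x y
    have h : (ContinuousLinearMap.id ℝ ℝ).adjoint = ContinuousLinearMap.id ℝ ℝ :=
      ContinuousLinearMap.adjoint_id
    simp [toMatrix, Matrix.conjTranspose_apply, ContinuousLinearMap.star_eq_adjoint, h, K.symm' x y]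
  · have h := K.nonneg' vv.support.card (fun i => vv (vv.support.equivFin.symm i))
      (fun i => vv.support.equivFin.symm i)
    have e : ∀ g : X → ℝ, ∑ i : Fin vv.support.card, g (vv.support.equivFin.symm i)
        = ∑ x ∈ vv.support, g x := fun g => by
      rw [← Finset.sum_coe_sort vv.support g]
      exact Equiv.sum_comp vv.support.equivFin.symm (fun x => g x)
    have e2 : ∑ i : Fin vv.support.card, ∑ j : Fin vv.support.card,
        vv (vv.support.equivFin.symm i) * vv (vv.support.equivFin.symm j)
          * K (vv.support.equivFin.symm i) (vv.support.equivFin.symm j)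
        = ∑ x ∈ vv.support, ∑ y ∈ vv.support, vv x * vv y * K x y := by
      rw [← e]
      exact Finset.sum_congr rfl fun i _ => e (fun y => vv (vv.support.equivFin.symm i) * vv y
        * K (vv.support.equivFin.symm i) y)
    rw [e2] at h
    refine h.trans (le_of_eq ?_)
    simp only [Finsupp.sum, toMatrix_apply, RCLike.re_to_real]
    refine Finset.sum_congr rfl fun x _ => Finset.sum_congr rfl fun y _ => ?_
    simp [K.symm' y x]
    ring

open scoped ComplexOrder in
instance instFactPosSemidefToMatrix {X : Type*} (K : ReproducingKernel X) :
    Fact K.toMatrix.PosSemidef :=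
  ⟨K.posSemidef_toMatrix⟩

/-- The reproducing kernel Hilbert space of `K` (Mathlib's construction); an element `f` is
regarded as a function `X → ℝ` through the coercion `f x`. -/
abbrev H {X : Type*} (K : ReproducingKernel X) : Type _ :=
  RKHS.OfKernel K.toMatrix

/-- The generator `k_x` of `K`, as an element of the reproducing kernel Hilbert space. -/
def gen {X : Type*} (K : ReproducingKernel X) (x : X) : K.H :=
  RKHS.kerFun K.H x (1 : ℝ)

theorem inner_gen_left {X : Type*} (K : ReproducingKernel X) (x : X) (f : K.H) :
    ⟪K.gen x, f⟫_ℝ = f x := by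
  rw [gen, RKHS.kerFun_inner]
  simp

theorem gen_apply {X : Type*} (K : ReproducingKernel X) (x y : X) : K.gen x y = K x y := by
  rw [gen, RKHS.kerFun_apply, RKHS.OfKernel.kernel_ofKernel, toMatrix_apply, mul_one, K.symm']

theorem inner_gen_gen {X : Type*} (K : ReproducingKernel X) (x y : X) :
    ⟪K.gen x, K.gen y⟫_ℝ = K x y := by
  rw [inner_gen_left, gen_apply, K.symm']

theorem denseRange_gen {X : Type*} (K : ReproducingKernel X) :
    DenseRange (Finsupp.linearCombination ℝ K.gen) := by
  have h := RKHS.kerFun_dense (𝕜 := ℝ) (X := X) (V := ℝ) K.H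
  have h1 : Submodule.span ℝ {x | ∃ (y : X) (v : ℝ), RKHS.kerFun K.H y v = x}
      ≤ LinearMap.range (Finsupp.linearCombination ℝ K.gen) := by
    rw [Submodule.span_le]
    rintro _ ⟨x, v, rfl⟩
    refine ⟨Finsupp.single x v, ?_⟩
    rw [Finsupp.linearCombination_single, gen, ← map_smul, smul_eq_mul, mul_one]
  have h2 : (LinearMap.range (Finsupp.linearCombination ℝ K.gen)).topologicalClosure = ⊤ :=
    top_le_iff.mp (h ▸ Submodule.topologicalClosure_mono h1)
  have h3 := Submodule.dense_iff_topologicalClosure_eq_top.mpr h2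
  rw [LinearMap.coe_range] at h3
  exact h3

/-- The bounded linear map on the reproducing kernel Hilbert space of `K` sending `k_x` to `φ x`;
used below only where `⟨φ x, φ y⟩ = K x y`, so that it exists and is an isometry. -/
def lift {X : Type*} (K : ReproducingKernel X) {E : Type*} [NormedAddCommGroup E]
    [InnerProductSpace ℝ E] [CompleteSpace E] (φ : X → E) : K.H →L[ℝ] E :=
  (Finsupp.linearCombination ℝ φ).extendOfNorm (Finsupp.linearCombination ℝ K.gen)

theorem inner_linearCombination {X : Type*} (K : ReproducingKernel X) {E : Type*}
    [NormedAddCommGroup E] [InnerProductSpace ℝ E] (φ : X → E)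
    (h : ∀ x y, ⟪φ x, φ y⟫_ℝ = K x y) (c : X →₀ ℝ) :
    ‖Finsupp.linearCombination ℝ φ c‖ = ‖Finsupp.linearCombination ℝ K.gen c‖ := by
  have key : ‖Finsupp.linearCombination ℝ φ c‖ ^ 2
      = ‖Finsupp.linearCombination ℝ K.gen c‖ ^ 2 := by
    rw [← real_inner_self_eq_norm_sq, ← real_inner_self_eq_norm_sq]
    simp only [Finsupp.linearCombination_apply, Finsupp.sum, sum_inner, inner_sum,
      real_inner_smul_left, real_inner_smul_right, h, inner_gen_gen]
  exact (sq_eq_sq₀ (norm_nonneg _) (norm_nonneg _)).mp key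

theorem lift_gen {X : Type*} (K : ReproducingKernel X) {E : Type*} [NormedAddCommGroup E]
    [InnerProductSpace ℝ E] [CompleteSpace E] (φ : X → E)
    (h : ∀ x y, ⟪φ x, φ y⟫_ℝ = K x y) (x : X) : K.lift φ (K.gen x) = φ x := by
  have := LinearMap.extendOfNorm_eq (f := Finsupp.linearCombination ℝ φ)
    (e := Finsupp.linearCombination ℝ K.gen) K.denseRange_gen
    ⟨1, fun c => by rw [one_mul, K.inner_linearCombination φ h]⟩ (Finsupp.single x 1)
  simpa [lift] using this

theorem inner_lift_lift {X : Type*} (K : ReproducingKernel X) {E : Type*} [NormedAddCommGroup E]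
    [InnerProductSpace ℝ E] [CompleteSpace E] (φ : X → E)
    (h : ∀ x y, ⟪φ x, φ y⟫_ℝ = K x y) (f g : K.H) :
    ⟪K.lift φ f, K.lift φ g⟫_ℝ = ⟪f, g⟫_ℝ := by
  have hb : ∃ C, ∀ c : X →₀ ℝ, ‖Finsupp.linearCombination ℝ φ c‖
      ≤ C * ‖Finsupp.linearCombination ℝ K.gen c‖ :=
    ⟨1, fun c => by rw [one_mul, K.inner_linearCombination φ h]⟩
  have hn : ∀ f : K.H, ‖K.lift φ f‖ = ‖f‖ := fun f => by
    refine isClosed_property (p := fun f : K.H => ‖K.lift φ f‖ = ‖f‖) K.denseRange_gen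
      (isClosed_eq (K.lift φ).continuous.norm continuous_norm) ?_ f
    intro c
    rw [lift, LinearMap.extendOfNorm_eq K.denseRange_gen hb, K.inner_linearCombination φ h]
  rw [real_inner_eq_norm_add_mul_self_sub_norm_mul_self_sub_norm_mul_self_div_two,
    real_inner_eq_norm_add_mul_self_sub_norm_mul_self_sub_norm_mul_self_div_two, ← map_add,
    hn, hn, hn]

/-- The subkernel `K_S`, the restriction of `K` to `S × S`. -/
def restrict {X : Type*} (K : ReproducingKernel X) (S : Set X) : ReproducingKernel S where
  toFun x y := K x y
  symm' x y := K.symm' x y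
  nonneg' n α x := K.nonneg' n α (fun i => x i)

/-- The function `k_{u,S} : S → ℝ`, `v ↦ K u v`, as an element of the reproducing kernel Hilbert
space of `K_S` (see `genOn_apply`); here `u` need not lie in `S`. It is obtained by applying to
`k_u` the restriction map, i.e. the adjoint of the isometry that sends `k_{v,S}` to `k_v`. -/
def genOn {X : Type*} (K : ReproducingKernel X) (S : Set X) (u : X) : (K.restrict S).H :=
  ContinuousLinearMap.adjoint ((K.restrict S).lift (fun v : S => K.gen v)) (K.gen u)

theorem genOn_apply {X : Type*} (K : ReproducingKernel X) (S : Set X) (u : X) (v : S) :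
    K.genOn S u v = K u v := by
  rw [← inner_gen_left, genOn, ContinuousLinearMap.adjoint_inner_right, lift_gen, inner_gen_gen,
    K.symm']
  exact fun x y => inner_gen_gen K x y

end ReproducingKernel

/-- `S` separates `x` and `y` in the graph on `X` with edge set `Ω`: neither point is in `S` and
every path `x = z 0, z 1, …, z (n + 1) = y` in `Ω` has an intermediate vertex in `S`. -/
def Separates {X : Type*} (Ω : Set (X × X)) (S : Set X) (x y : X) : Prop :=
  x ∉ S ∧ y ∉ S ∧ ∀ (n : ℕ) (z : ℕ → X), z 0 = x → z (n + 1) = y →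
    (∀ k ≤ n, (z k, z (k + 1)) ∈ Ω) → ∃ k, 1 ≤ k ∧ k ≤ n ∧ z k ∈ S

/-- `K` is a completion of the partial kernel `KΩ` on the domain `Ω`; only the values of `KΩ` on
`Ω` matter. -/
def IsCompletion {X : Type*} (Ω : Set (X × X)) (KΩ : X → X → ℝ) (K : ReproducingKernel X) : Prop :=
  ∀ x y, (x, y) ∈ Ω → K x y = KΩ x y

/-- `K` is a canonical completion of `KΩ`: a completion with
`K x y = ⟨k_{x,S}, k_{y,S}⟩` (inner product of the reproducing kernel Hilbert space of `K_S`)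
whenever `S` separates `x` and `y` in `Ω`. -/
def IsCanonicalCompletion {X : Type*} (Ω : Set (X × X)) (KΩ : X → X → ℝ)
    (K : ReproducingKernel X) : Prop :=
  IsCompletion Ω KΩ K ∧
    ∀ (S : Set X) (x y : X), Separates Ω S x y → K x y = ⟪K.genOn S x, K.genOn S y⟫_ℝ

/-- `F` is a (real) positive-definite function on `[-a, a]`: it is even and
`∑ αᵢ αⱼ F (xᵢ - xⱼ) ≥ 0` for all finitely many points whose differences lie in `[-a, a]`. Only the
values of `F` on `[-a, a]` matter. -/
structure IsPosDefOn (a : ℝ) (F : ℝ → ℝ) : Prop where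
  even' : ∀ t, |t| ≤ a → F (-t) = F t
  nonneg' : ∀ (n : ℕ) (α : Fin n → ℝ) (x : Fin n → ℝ), (∀ i j, |x i - x j| ≤ a) →
    0 ≤ ∑ i, ∑ j, α i * α j * F (x i - x j)

/-- The band `{(x, y) : |x - y| ≤ a}` in `ℝ × ℝ`. -/
def band (a : ℝ) : Set (ℝ × ℝ) := {p | |p.1 - p.2| ≤ a}

/-- `Ft : ℝ → ℝ` is a canonical extension of the function `F` on `[-a, a]`: `Ft (x - y)` is a
canonical completion, on the real line, of the partial kernel `F (x - y)`, `|x - y| ≤ a`. -/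
def IsCanonicalExtension (a : ℝ) (F : ℝ → ℝ) (Ft : ℝ → ℝ) : Prop :=
  ∃ K : ReproducingKernel ℝ, (∀ x y, K x y = Ft (x - y)) ∧
    IsCanonicalCompletion (band a) (fun x y => F (x - y)) K

namespace IsPosDefOn

/-- The reproducing kernel `(x, y) ↦ F (x - y)` on the interval `[c, d]` of length at most `a`. -/
def kernelOn {a : ℝ} {F : ℝ → ℝ} (hF : IsPosDefOn a F) (c d : ℝ) (hcd : d - c ≤ a) :
    ReproducingKernel (Icc c d) where
  toFun x y := F (x - y)
  symm' x y := by
    have h := hF.even' ((y : ℝ) - x)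
      (abs_le.mpr ⟨by linarith [x.2.1, x.2.2, y.2.1, y.2.2], by linarith [x.2.1, x.2.2, y.2.1, y.2.2]⟩)
    rwa [neg_sub] at h
  nonneg' n α x := hF.nonneg' n α (fun i => x i) fun i j =>
    abs_le.mpr ⟨by linarith [(x i).2.1, (x i).2.2, (x j).2.1, (x j).2.2],
      by linarith [(x i).2.1, (x i).2.2, (x j).2.1, (x j).2.2]⟩

/-- The kernel `K(x, y) = F (x - y)` on `[0, a]`. -/
abbrev K {a : ℝ} {F : ℝ → ℝ} (hF : IsPosDefOn a F) : ReproducingKernel (Icc 0 a) :=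
  hF.kernelOn 0 a (by linarith)

/-- The kernel `K_{I_t}(x, y) = F (x - y)` on `I_t = [t, t + a]`. -/
abbrev KI {a : ℝ} {F : ℝ → ℝ} (hF : IsPosDefOn a F) (t : ℝ) : ReproducingKernel (Icc t (t + a)) :=
  hF.kernelOn t (t + a) (by linarith)

/-- The translation `T_s` from the space of `K` to the space of `K_{I_s}`, `T_s g (u) = g (u - s)`
(see `translate_apply`), given on generators by `k_u ↦ k_{u + s}`. -/
def translate {a : ℝ} {F : ℝ → ℝ} (hF : IsPosDefOn a F) (s : ℝ) : hF.K.H →L[ℝ] (hF.KI s).H :=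
  hF.K.lift fun u : Icc 0 a =>
    (hF.KI s).gen ⟨u + s, by linarith [u.2.1], by linarith [u.2.2]⟩

theorem translate_apply {a : ℝ} {F : ℝ → ℝ} (hF : IsPosDefOn a F) (s : ℝ) (g : hF.K.H)
    (u : Icc s (s + a)) :
    hF.translate s g u = g ⟨u - s, by linarith [u.2.1], by linarith [u.2.2]⟩ := by
  have hφ : ∀ x y : Icc (0 : ℝ) a,
      ⟪(hF.KI s).gen ⟨x + s, by linarith [x.2.1], by linarith [x.2.2]⟩,
        (hF.KI s).gen ⟨y + s, by linarith [y.2.1], by linarith [y.2.2]⟩⟫_ℝ = hF.K x y := by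
    intro x y
    rw [ReproducingKernel.inner_gen_gen]
    simp [kernelOn]
  have h1 := hF.K.inner_lift_lift _ hφ
    (hF.K.gen ⟨u - s, by linarith [u.2.1], by linarith [u.2.2]⟩) g
  rw [ReproducingKernel.lift_gen _ _ hφ] at h1
  simp only [sub_add_cancel] at h1
  rw [ReproducingKernel.inner_gen_left, ReproducingKernel.inner_gen_left] at h1
  exact h1

end IsPosDefOn

/-- A strongly continuous semigroup of contractions `(Φ t)_{t ≥ 0}` on a Hilbert space. -/
structure IsContractionSemigroup {E : Type*} [NormedAddCommGroup E] [InnerProductSpace ℝ E]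
    (Φ : ℝ≥0 → E →L[ℝ] E) : Prop where
  zero' : Φ 0 = ContinuousLinearMap.id ℝ E
  add' : ∀ s t, Φ (s + t) = Φ s ∘L Φ t
  contraction' : ∀ t, ‖Φ t‖ ≤ 1
  tendsto' : ∀ g, Tendsto (fun h => ‖Φ h g - g‖) (𝓝[>] 0) (𝓝 0)

/-- A strongly continuous semigroup of contractions on the space of `K` with
`Φ_t k_u = k_{u - t}` for `0 ≤ t ≤ u ≤ a`. -/
def IsCanonicalSemigroup {a : ℝ} {F : ℝ → ℝ} (hF : IsPosDefOn a F)
    (Φ : ℝ≥0 → hF.K.H →L[ℝ] hF.K.H) : Prop :=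
  IsContractionSemigroup Φ ∧
    ∀ (t : ℝ≥0) (u : Icc 0 a) (h : (t : ℝ) ≤ u),
      Φ t (hF.K.gen u) =
        hF.K.gen ⟨u - t, by linarith, by linarith [u.2.2, t.coe_nonneg]⟩

/-- The maps `Φ s t` from the space of `K_{I_t}` to the space of `K_{I_s}` are those attached to
`Ft`: `Φ s t` sends the generator `k_{u, I_t}`, `u ∈ I_t`, to the function `w ↦ Ft (u - w)` on
`I_s`. -/
def IsTransitionFamily {a : ℝ} {F : ℝ → ℝ} (hF : IsPosDefOn a F) (Ft : ℝ → ℝ)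
    (Φ : ∀ s t : ℝ, (hF.KI t).H →L[ℝ] (hF.KI s).H) : Prop :=
  ∀ (s t : ℝ) (u : Icc t (t + a)) (w : Icc s (s + a)), Φ s t ((hF.KI t).gen u) w = Ft (u - w)

end

/-! Let `K` be the kernel of a stationary extension, with generators `k_u`. Since `K` agrees with
`F` near the diagonal, `k_u ↦ k_{u+c}` embeds the space of `[0, a]` isometrically in the space of
`K`, for each `c` (`shift`). The adjoint restricts to `[c, c + a]`, and embedding after adjoint is
the orthogonal projection onto the span of `[c, c + a]`. So `⟨k_{x,S}, k_{y,S}⟩` is `⟨k_x, P_S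
k_y⟩`, and canonicity is a Markov property: `P_S` may be inserted whenever `S` separates.

From extension to semigroup, the operator `Φ_s` is an embedding followed by the adjoint of another.
A product `Φ_s Φ_t` contains the projection of `[0, a]`, and the Markov property at `[0, a]` removes
it.

From semigroup to extension, positivity of `⟨k_0, Φ_{|x-y|} k_0⟩` is an induction on the largest
point (`norm_sq_sum_le`). As `Φ_s k_s = k_0` preserves norm and `Φ_s` is a contraction, `Φ_s^* k_0 =
k_s`. Hence every matrix entry `⟨k_w, Φ_t k_u⟩` is a value of the extension (`inner_gen_apply_gen`),
which gives injectivity, and the semigroup law becomes the Markov property at all intervals of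
length `a`. This suffices: a separating set contains an open interval of length `a` between the two
points, continuity supplies its endpoints, and the Markov property passes to larger sets
(`inner_eq_inner_starProjection_of_markov`). -/

/-! ### Closed spans, projections and the Markov property -/

section ClosedSpan

variable {E : Type*} [NormedAddCommGroup E] [InnerProductSpace ℝ E]

/-- The closed linear span of a set of vectors. -/
abbrev closedSpan (A : Set E) : Submodule ℝ E :=
  (Submodule.span ℝ A).topologicalClosure

theorem subset_closedSpan (A : Set E) : A ⊆ closedSpan A :=
  Submodule.subset_span.trans (Submodule.le_topologicalClosure _)

theorem closedSpan_le {A : Set E} {M : Submodule ℝ E} (hM : IsClosed (M : Set E)) (h : A ⊆ M) :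
    closedSpan A ≤ M :=
  Submodule.topologicalClosure_minimal _ (Submodule.span_le.mpr h) hM

theorem closedSpan_mono {A B : Set E} (h : A ⊆ closedSpan B) : closedSpan A ≤ closedSpan B :=
  closedSpan_le (Submodule.isClosed_topologicalClosure _) h

theorem inner_eq_zero_of_mem_closedSpan {A : Set E} {v m : E} (h : ∀ x ∈ A, ⟪v, x⟫_ℝ = 0)
    (hm : m ∈ closedSpan A) : ⟪v, m⟫_ℝ = 0 := by
  have hle : closedSpan A ≤ (ℝ ∙ v)ᗮ :=
    closedSpan_le (Submodule.isClosed_orthogonal _) fun x hx =>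
      Submodule.mem_orthogonal_singleton_iff_inner_right.mpr (h x hx)
  exact Submodule.mem_orthogonal_singleton_iff_inner_right.mp (hle hm)

variable [CompleteSpace E]

theorem starProjection_closedSpan_eq {A : Set E} {v q : E} (hq : q ∈ closedSpan A)
    (h : ∀ x ∈ A, ⟪v - q, x⟫_ℝ = 0) : (closedSpan A).starProjection v = q :=
  Submodule.eq_starProjection_of_mem_of_inner_eq_zero hq fun _ hm =>
    inner_eq_zero_of_mem_closedSpan h hm

/-- A curve `e` with the Markov property at the interval `[c, d]` has the Markov property at each
set `S` whose closed span contains that of `[c, d]`. -/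
theorem inner_eq_inner_starProjection_of_markov {e : ℝ → E} {c d : ℝ} {S : Set ℝ}
    (hS : ∀ u ∈ Icc c d, e u ∈ closedSpan (e '' S))
    (hM : ∀ u ≤ c, ∀ v ≥ d, ⟪e u, e v⟫_ℝ = ⟪e u, (closedSpan (e '' Icc c d)).starProjection (e v)⟫_ℝ)
    {x y : ℝ} (hx : x ≤ c) (hy : d ≤ y) :
    ⟪e x, e y⟫_ℝ = ⟪e x, (closedSpan (e '' S)).starProjection (e y)⟫_ℝ := by
  -- Points of `S` left of `c` are left out of `B`. The Markov property makes the residual `e y - q`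
  -- orthogonal to them anyway, so `q` is also the projection onto the span of `S`.
  set B : Set E := e '' (Icc c d ∪ S ∩ Ici d) with hB
  set P := (closedSpan (e '' Icc c d)).starProjection with hP
  set q := (closedSpan B).starProjection (e y) with hq
  have hq_mem : q ∈ closedSpan B := Submodule.starProjection_apply_mem _ _
  have hortho : ∀ m ∈ closedSpan B, ⟪e y - q, m⟫_ℝ = 0 := fun m hm =>
    Submodule.starProjection_inner_eq_zero _ _ hm
  have hIB : closedSpan (e '' Icc c d) ≤ closedSpan B :=
    closedSpan_mono ((image_mono subset_union_left).trans (subset_closedSpan _))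
  have hright : ∀ u ≤ c, ∀ v ≥ d, ⟪e u - P (e u), e v⟫_ℝ = 0 := fun u hu v hv => by
    rw [inner_sub_left, hM u hu v hv, hP, Submodule.inner_starProjection_left_eq_right, sub_self]
  have hleft : ∀ u ≤ c, ⟪e u, e y - q⟫_ℝ = 0 := fun u hu => by
    have h1 : ⟪e u - P (e u), q⟫_ℝ = 0 := by
      refine inner_eq_zero_of_mem_closedSpan ?_ hq_mem
      rintro _ ⟨v, hv | hv, rfl⟩
      · exact Submodule.starProjection_inner_eq_zero _ _ (subset_closedSpan _ ⟨v, hv, rfl⟩)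
      · exact hright u hu v hv.2
    have h2 : ⟪P (e u), e y - q⟫_ℝ = 0 := by
      rw [real_inner_comm]
      exact hortho _ (hIB (Submodule.starProjection_apply_mem _ _))
    calc ⟪e u, e y - q⟫_ℝ = ⟪e u - P (e u), e y⟫_ℝ - ⟪e u - P (e u), q⟫_ℝ
          + ⟪P (e u), e y - q⟫_ℝ := by
          simp only [inner_sub_left, inner_sub_right]; ring
      _ = 0 := by rw [hright u hu y hy, h1, h2]; ring
  have hproj : (closedSpan (e '' S)).starProjection (e y) = q := by
    refine starProjection_closedSpan_eq ?_ ?_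
    · refine closedSpan_mono ?_ hq_mem
      rintro _ ⟨v, hv | hv, rfl⟩
      · exact hS v hv
      · exact subset_closedSpan _ ⟨v, hv.1, rfl⟩
    · rintro _ ⟨u, hu, rfl⟩
      rcases le_total u c with huc | huc
      · rw [real_inner_comm]
        exact hleft u huc
      · refine hortho _ (subset_closedSpan _ ⟨u, ?_, rfl⟩)
        rcases le_total u d with hud | hud
        · exact Or.inl ⟨huc, hud⟩
        · exact Or.inr ⟨hu, hud⟩
  rw [hproj, ← sub_eq_zero, ← inner_sub_right]
  exact hleft x hx

end ClosedSpan

/-! ### Isometries out of a reproducing kernel space and their adjoints -/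

namespace ReproducingKernel

variable {X : Type*} (K : ReproducingKernel X)

theorem eq_of_inner_gen {f g : K.H} (h : ∀ x, ⟪K.gen x, f⟫_ℝ = ⟪K.gen x, g⟫_ℝ) : f = g :=
  RKHS.ext fun x => by rw [← K.inner_gen_left, ← K.inner_gen_left, h]

theorem clm_ext {E : Type*} [NormedAddCommGroup E] [InnerProductSpace ℝ E] {A B : K.H →L[ℝ] E}
    (h : ∀ x, A (K.gen x) = B (K.gen x)) : A = B := by
  refine DFunLike.coe_injective (K.denseRange_gen.equalizer A.continuous B.continuous ?_)
  funext c
  simp only [Function.comp_apply, Finsupp.linearCombination_apply, Finsupp.sum, map_sum, map_smul,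
    h]

variable {E : Type*} [NormedAddCommGroup E] [InnerProductSpace ℝ E] [CompleteSpace E]
variable {φ : X → E} (h : ∀ x y, ⟪φ x, φ y⟫_ℝ = K x y)

include h

theorem norm_lift_le_one : ‖K.lift φ‖ ≤ 1 := by
  refine ContinuousLinearMap.opNorm_le_bound _ zero_le_one fun f => ?_
  rw [one_mul, ← sq_le_sq₀ (norm_nonneg _) (norm_nonneg _), ← real_inner_self_eq_norm_sq,
    ← real_inner_self_eq_norm_sq, K.inner_lift_lift φ h]

theorem inner_gen_adjoint_lift (x : X) (v : E) :
    ⟪K.gen x, (K.lift φ).adjoint v⟫_ℝ = ⟪φ x, v⟫_ℝ := by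
  rw [ContinuousLinearMap.adjoint_inner_right, K.lift_gen φ h]

theorem lift_mem_closedSpan (f : K.H) : K.lift φ f ∈ closedSpan (range φ) := by
  refine isClosed_property (p := fun f : K.H => K.lift φ f ∈ closedSpan (range φ))
    K.denseRange_gen ((Submodule.isClosed_topologicalClosure _).preimage (K.lift φ).continuous)
    (fun c => ?_) f
  simp only [Finsupp.linearCombination_apply, Finsupp.sum, map_sum, map_smul, K.lift_gen φ h]
  exact Submodule.sum_mem _ fun x _ => Submodule.smul_mem _ _ (subset_closedSpan _ ⟨x, rfl⟩)

/-- An isometry `J` satisfies `J^* J = 1`, so `v - J J^* v` is orthogonal to the range of `J`. -/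
theorem lift_adjoint_lift (v : E) :
    K.lift φ ((K.lift φ).adjoint v) = (closedSpan (range φ)).starProjection v := by
  refine (starProjection_closedSpan_eq (K.lift_mem_closedSpan h _) ?_).symm
  rintro _ ⟨x, rfl⟩
  rw [real_inner_comm, inner_sub_right, sub_eq_zero, ← K.inner_gen_adjoint_lift h]
  rw [← K.lift_gen φ h x, K.inner_lift_lift φ h]

theorem inner_adjoint_lift (v w : E) :
    ⟪(K.lift φ).adjoint v, (K.lift φ).adjoint w⟫_ℝ
      = ⟪v, (closedSpan (range φ)).starProjection w⟫_ℝ := by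
  rw [ContinuousLinearMap.adjoint_inner_left, K.lift_adjoint_lift h]

omit h

/-- Turns the canonical condition, posed in the space of `K_S`, into one about projections in the
single space of `K`. -/
theorem inner_genOn (S : Set X) (x y : X) :
    ⟪K.genOn S x, K.genOn S y⟫_ℝ
      = ⟪K.gen x, (closedSpan (K.gen '' S)).starProjection (K.gen y)⟫_ℝ := by
  have hr : K.gen '' S = range fun v : S => K.gen v := image_eq_range _ _
  rw [hr]
  exact (K.restrict S).inner_adjoint_lift (φ := fun v : S => K.gen v)
    (fun u v => K.inner_gen_gen u v) (K.gen x) (K.gen y)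

end ReproducingKernel

/-! ### Separation in the band -/

theorem Separates.symm {X : Type*} {Ω : Set (X × X)} (hΩ : ∀ x y, (x, y) ∈ Ω → (y, x) ∈ Ω)
    {S : Set X} {x y : X} (h : Separates Ω S x y) : Separates Ω S y x := by
  refine ⟨h.2.1, h.1, fun n z h0 h1 hz => ?_⟩
  obtain ⟨k, hk1, hkn, hk⟩ := h.2.2 n (fun k => z (n + 1 - k)) (by simpa using h1) (by simpa using h0)
    fun k hk => by
      have e : n + 1 - k = (n - k) + 1 := by omega
      have e' : n + 1 - (k + 1) = n - k := by omega
      simp only [e, e']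
      exact hΩ _ _ (hz _ (by omega))
  exact ⟨n + 1 - k, by omega, by omega, hk⟩

theorem mem_band {a x y : ℝ} : (x, y) ∈ band a ↔ |x - y| ≤ a := Iff.rfl

theorem band_symm {a x y : ℝ} (h : (x, y) ∈ band a) : (y, x) ∈ band a := by
  simpa [band, abs_sub_comm] using h

/-- Steps of length at most `a` cannot jump over a closed interval of length `a`: from above `c + a`
a step lands above `c`, hence in the interval or again above it. -/
theorem separates_band_Icc {a c x y : ℝ} (hx : c + a < x) (hy : y < c) :
    Separates (band a) (Icc c (c + a)) x y := by
  refine ⟨fun h => hx.not_ge h.2, fun h => hy.not_ge h.1, fun n z h0 h1 hz => ?_⟩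
  by_contra! hcon
  have key : ∀ k ≤ n, c + a < z k := by
    intro k
    induction k with
    | zero => intro _; rwa [h0]
    | succ k ih =>
      intro hk
      have h2 := ih (by omega)
      have h3 := abs_le.mp (mem_band.mp (hz k (by omega)))
      by_contra! h4
      exact hcon (k + 1) (by omega) hk ⟨by linarith, h4⟩
  have h2 := key n le_rfl
  have h3 := abs_le.mp (mem_band.mp (hz n le_rfl))
  rw [h1] at h3
  linarith

/-- A set separating `x < y` in the band of width `a` contains the interior of an interval of
length `a` between them. -/
theorem Separates.exists_Ioo_subset {a : ℝ} (ha : 0 < a) {S : Set ℝ} {x y : ℝ}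
    (h : Separates (band a) S x y) (hxy : x ≤ y) :
    ∃ c, x ≤ c ∧ c + a ≤ y ∧ Ioo c (c + a) ⊆ S := by
  -- The points up to `y` reachable from `x` by paths avoiding `S`; the interval sought starts at
  -- `sSup R`. By separation no such point is within `a` of `y`.
  let R : Set ℝ := {w | w ≤ y ∧ ∃ (n : ℕ) (z : ℕ → ℝ), z 0 = x ∧ z n = w ∧
    (∀ k < n, (z k, z (k + 1)) ∈ band a) ∧ ∀ k, 1 ≤ k → k ≤ n → z k ∉ S}
  have hxR : x ∈ R := ⟨hxy, 0, fun _ => x, rfl, rfl, by simp, fun k h1 h2 => by omega⟩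
  have hstep : ∀ w ∈ R, ∀ v, |w - v| ≤ a → v ∉ S → v ≤ y → v ∈ R := by
    rintro w ⟨-, n, z, h0, hn, hz, hzS⟩ v hv hvS hvy
    refine ⟨hvy, n + 1, fun k => if k ≤ n then z k else v, by simp [h0], by simp, ?_, ?_⟩
    · intro k hk
      rcases Nat.lt_or_ge k n with hkn | hkn
      · simpa [hkn.le, Nat.succ_le_of_lt hkn] using hz k hkn
      · obtain rfl : k = n := by omega
        simpa [band, hn] using hv
    · intro k hk1 hk2
      by_cases hkn : k ≤ n
      · simpa [hkn] using hzS k hk1 hkn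
      · simpa [hkn] using hvS
  have hfar : ∀ w ∈ R, w + a < y := by
    rintro w ⟨hwy, n, z, h0, hn, hz, hzS⟩
    by_contra! hcon
    obtain ⟨k, hk1, hkn, hk⟩ := h.2.2 n (fun k => if k ≤ n then z k else y) (by simp [h0]) (by simp)
      fun k hk => by
        rcases hk.lt_or_eq with hkn | rfl
        · simpa [hkn.le, Nat.succ_le_of_lt hkn] using hz k hkn
        · simp only [le_refl, if_true, hn, Nat.not_succ_le_self, if_false]
          exact mem_band.mpr (abs_le.mpr ⟨by linarith, by linarith⟩)
    simp only [hkn, if_true] at hk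
    exact hzS k hk1 hkn hk
  have hbdd : BddAbove R := ⟨y, fun w hw => hw.1⟩
  refine ⟨sSup R, le_csSup hbdd hxR, ?_, ?_⟩
  · have : sSup R ≤ y - a := csSup_le ⟨x, hxR⟩ fun w hw => by linarith [hfar w hw]
    linarith
  · rintro v ⟨hv1, hv2⟩
    -- A point `v` of the interval outside `S` would be one step from `w`, hence in `R`, although it
    -- exceeds the supremum.
    obtain ⟨w, hw, hvw⟩ := exists_lt_of_lt_csSup ⟨x, hxR⟩ (by linarith : v - a < sSup R)
    have hwle := le_csSup hbdd hw
    by_contra hvS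
    have := le_csSup hbdd (hstep w hw v (abs_le.mpr ⟨by linarith, by linarith⟩) hvS
      (by linarith [hfar w hw]))
    linarith

/-! ### Contractions -/

/-- A bounded family of operators that tends strongly to the identity on a set with dense span does
so everywhere. -/
theorem tendsto_clm_apply_of_dense {ι E : Type*} [NormedAddCommGroup E] [InnerProductSpace ℝ E]
    {l : Filter ι} {Φ : ι → E →L[ℝ] E} (hb : ∀ i, ‖Φ i‖ ≤ 1) {D : Set E} (hD : Dense D)
    (h : ∀ g ∈ D, Tendsto (fun i => Φ i g) l (𝓝 g)) (g : E) :
    Tendsto (fun i => Φ i g) l (𝓝 g) := by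
  rw [Metric.tendsto_nhds]
  intro ε hε
  obtain ⟨d, hd, hdg⟩ := hD.exists_dist_lt g (by positivity : 0 < ε / 3)
  filter_upwards [Metric.tendsto_nhds.mp (h d hd) (ε / 3) (by positivity)] with i hi
  have h1 : dist (Φ i g) (Φ i d) ≤ dist g d := by
    rw [dist_eq_norm, dist_eq_norm, ← map_sub]
    exact ((Φ i).le_of_opNorm_le (hb i) _).trans_eq (one_mul _)
  have h2 := dist_triangle4 (Φ i g) (Φ i d) d g
  rw [dist_comm d g] at h2
  linarith

theorem norm_clm_apply_le {E G : Type*} [NormedAddCommGroup E] [InnerProductSpace ℝ E]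
    [NormedAddCommGroup G] [InnerProductSpace ℝ G] {A : E →L[ℝ] G} (hA : ‖A‖ ≤ 1) (g : E) :
    ‖A g‖ ≤ ‖g‖ :=
  (A.le_of_opNorm_le hA g).trans_eq (one_mul _)

theorem opNorm_comp_le_one {E G H : Type*} [NormedAddCommGroup E] [InnerProductSpace ℝ E]
    [NormedAddCommGroup G] [InnerProductSpace ℝ G] [NormedAddCommGroup H] [InnerProductSpace ℝ H]
    {A : G →L[ℝ] H} {B : E →L[ℝ] G} (hA : ‖A‖ ≤ 1) (hB : ‖B‖ ≤ 1) : ‖A ∘L B‖ ≤ 1 :=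
  (A.opNorm_comp_le B).trans (mul_le_one₀ hA (norm_nonneg _) hB)

/-! ### Stationary extensions and the shifted embeddings of `[0, a]` -/

namespace IsPosDefOn

variable {a : ℝ} {F : ℝ → ℝ} (hF : IsPosDefOn a F)

theorem kernelOn_apply {c d : ℝ} (hcd : d - c ≤ a) (x y : Icc c d) :
    hF.kernelOn c d hcd x y = F (x - y) := rfl

theorem inner_gen_add (s : ℝ) (x y : Icc (0 : ℝ) a) :
    ⟪(hF.KI s).gen ⟨x + s, by linarith [x.2.1], by linarith [x.2.2]⟩,
      (hF.KI s).gen ⟨y + s, by linarith [y.2.1], by linarith [y.2.2]⟩⟫_ℝ = hF.K x y := by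
  rw [ReproducingKernel.inner_gen_gen]
  simp [kernelOn_apply]

theorem translate_gen (s : ℝ) (u : Icc (0 : ℝ) a) :
    hF.translate s (hF.K.gen u)
      = (hF.KI s).gen ⟨u + s, by linarith [u.2.1], by linarith [u.2.2]⟩ :=
  hF.K.lift_gen _ (hF.inner_gen_add s) u

theorem norm_translate_le_one (s : ℝ) : ‖hF.translate s‖ ≤ 1 :=
  hF.K.norm_lift_le_one (hF.inner_gen_add s)

/-- The kernel `K` extends the function `F` on `[-a, a]` to the stationary kernel `Ft (x - y)`. -/
structure Extends (F : ℝ → ℝ) (a : ℝ) (Ft : ℝ → ℝ) (K : ReproducingKernel ℝ) : Prop where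
  apply_eq : ∀ x y, K x y = Ft (x - y)
  eq_of_abs_le : ∀ t, |t| ≤ a → Ft t = F t

namespace Extends

variable {hF} {Ft : ℝ → ℝ} {K : ReproducingKernel ℝ} (hK : Extends F a Ft K)

include hK

theorem even (t : ℝ) : Ft (-t) = Ft t := by
  have := K.symm' 0 t
  rw [hK.apply_eq, hK.apply_eq] at this
  simpa using this

theorem inner_gen_add (hF : IsPosDefOn a F) {c d : ℝ} (hcd : d - c ≤ a) (r : ℝ) (x y : Icc c d) :
    ⟪K.gen (x + r), K.gen (y + r)⟫_ℝ = hF.kernelOn c d hcd x y := by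
  rw [K.inner_gen_gen, hK.apply_eq, kernelOn_apply, add_sub_add_right_eq_sub, hK.eq_of_abs_le]
  exact abs_le.mpr ⟨by linarith [x.2.1, x.2.2, y.2.1, y.2.2], by linarith [x.2.1, x.2.2, y.2.1, y.2.2]⟩

theorem inner_gen_gen (hF : IsPosDefOn a F) {c d : ℝ} (hcd : d - c ≤ a) (x y : Icc c d) :
    ⟪K.gen x, K.gen y⟫_ℝ = hF.kernelOn c d hcd x y := by
  simpa using hK.inner_gen_add hF hcd 0 x y

omit hK in
/-- The isometry `k_u ↦ k_{u + c}` from the space of `F (x - y)` on `[0, a]` to the space of the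
extended kernel. -/
noncomputable def shift (hF : IsPosDefOn a F) (K : ReproducingKernel ℝ) (c : ℝ) :
    hF.K.H →L[ℝ] K.H :=
  hF.K.lift fun u : Icc 0 a => K.gen (u + c)

theorem inner_gen_shift_adjoint (hF : IsPosDefOn a F) (c : ℝ) (w : Icc 0 a) (v : K.H) :
    ⟪hF.K.gen w, (shift hF K c).adjoint v⟫_ℝ = ⟪K.gen (w + c), v⟫_ℝ :=
  hF.K.inner_gen_adjoint_lift (hK.inner_gen_add hF _ c) w v

theorem shift_gen (hF : IsPosDefOn a F) (c : ℝ) (w : Icc 0 a) :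
    shift hF K c (hF.K.gen w) = K.gen (w + c) :=
  hF.K.lift_gen _ (hK.inner_gen_add hF _ c) w

omit hK in
theorem range_gen_add (c : ℝ) :
    (range fun u : Icc 0 a => K.gen (u + c)) = K.gen '' Icc c (c + a) := by
  ext v
  constructor
  · rintro ⟨u, rfl⟩
    exact ⟨u + c, ⟨by linarith [u.2.1], by linarith [u.2.2]⟩, rfl⟩
  · rintro ⟨u, hu, rfl⟩
    exact ⟨⟨u - c, by linarith [hu.1], by linarith [hu.2]⟩, by simp⟩

theorem inner_shift_adjoint (hF : IsPosDefOn a F) (c : ℝ) (v w : K.H) :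
    ⟪(shift hF K c).adjoint v, (shift hF K c).adjoint w⟫_ℝ
      = ⟪v, (closedSpan (K.gen '' Icc c (c + a))).starProjection w⟫_ℝ := by
  rw [← range_gen_add]
  exact hF.K.inner_adjoint_lift (hK.inner_gen_add hF _ c) v w

/-- The square root is `‖k_x - k_y‖` for `x - y = t`; it also bounds `‖Φ_t k_u - k_u‖`. -/
theorem tendsto_sqrt (ha : 0 < a) (hcont : ContinuousOn F (Icc (-a) a)) :
    Tendsto (fun t => √(2 * Ft 0 - 2 * Ft t)) (𝓝 0) (𝓝 0) := by
  have hnear : ∀ᶠ t in 𝓝 (0 : ℝ), F t = Ft t := by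
    filter_upwards [Icc_mem_nhds (neg_lt_zero.mpr ha) ha] with t ht
    exact (hK.eq_of_abs_le t (abs_le.mpr ht)).symm
  have h0 : ContinuousAt Ft 0 :=
    (hcont.continuousAt (Icc_mem_nhds (neg_lt_zero.mpr ha) ha)).congr hnear
  have h1 : Tendsto (fun t => √(2 * Ft 0 - 2 * Ft t)) (𝓝 0) (𝓝 √(2 * Ft 0 - 2 * Ft 0)) :=
    (Real.continuous_sqrt.tendsto _).comp (Tendsto.const_sub _ (h0.tendsto.const_mul _))
  simpa using h1

theorem continuous_gen (ha : 0 < a) (hcont : ContinuousOn F (Icc (-a) a)) : Continuous K.gen := by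
  have hnorm : ∀ x y, ‖K.gen x - K.gen y‖ = √(2 * Ft 0 - 2 * Ft (x - y)) := fun x y => by
    rw [← Real.sqrt_sq (norm_nonneg _), norm_sub_sq_real, ← real_inner_self_eq_norm_sq,
      ← real_inner_self_eq_norm_sq]
    simp only [K.inner_gen_gen, hK.apply_eq, sub_self]
    congr 1
    ring
  refine continuous_iff_continuousAt.mpr fun y => ?_
  rw [ContinuousAt, tendsto_iff_norm_sub_tendsto_zero]
  simp only [hnorm]
  exact (hK.tendsto_sqrt ha hcont).comp
    ((continuous_id.sub continuous_const).tendsto' y 0 (sub_self y))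

/-- Separation yields only an open interval inside `S`; continuity of `u ↦ k_u` recovers the
endpoints. -/
theorem gen_mem_closedSpan (ha : 0 < a) (hcont : ContinuousOn F (Icc (-a) a)) {c : ℝ} {S : Set ℝ}
    (hS : Ioo c (c + a) ⊆ S) {u : ℝ} (hu : u ∈ Icc c (c + a)) :
    K.gen u ∈ closedSpan (K.gen '' S) := by
  rw [← closure_Ioo (by linarith)] at hu
  have h1 := image_closure_subset_closure_image (hK.continuous_gen ha hcont) ⟨u, hu, rfl⟩
  exact closure_minimal ((image_mono hS).trans (subset_closedSpan _))
    (Submodule.isClosed_topologicalClosure _) h1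

/-- The Markov property at all intervals of length `a` makes an extension canonical. -/
theorem isCanonicalExtension (ha : 0 < a) (hcont : ContinuousOn F (Icc (-a) a))
    (hM : ∀ c, ∀ u ≤ c, ∀ v ≥ c + a, ⟪K.gen u, K.gen v⟫_ℝ
      = ⟪K.gen u, (closedSpan (K.gen '' Icc c (c + a))).starProjection (K.gen v)⟫_ℝ) :
    IsCanonicalExtension a F Ft := by
  refine ⟨K, hK.apply_eq, fun x y hxy => ?_, ?_⟩
  · rw [hK.apply_eq, hK.eq_of_abs_le _ (mem_band.mp hxy)]
  · have key : ∀ (S : Set ℝ) (x y : ℝ), Separates (band a) S x y → x ≤ y →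
        K x y = ⟪K.genOn S x, K.genOn S y⟫_ℝ := fun S x y hS hxy => by
      obtain ⟨c, hxc, hcy, hcS⟩ := hS.exists_Ioo_subset ha hxy
      rw [K.inner_genOn, ← K.inner_gen_gen]
      exact inner_eq_inner_starProjection_of_markov
        (fun u hu => hK.gen_mem_closedSpan ha hcont hcS hu) (hM c) hxc hcy
    intro S x y hS
    rcases le_total x y with hxy | hxy
    · exact key S x y hS hxy
    · rw [K.symm', real_inner_comm]
      exact key S y x (hS.symm fun _ _ => band_symm) hxy

end Extends

end IsPosDefOn

/-! ### From a canonical extension to its semigroup -/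

namespace IsTransitionFamily

open IsPosDefOn

variable {a : ℝ} {F : ℝ → ℝ} {hF : IsPosDefOn a F} {Ft : ℝ → ℝ}
  {Φ : ∀ s t : ℝ, (hF.KI t).H →L[ℝ] (hF.KI s).H}

theorem unique {Φ' : ∀ s t : ℝ, (hF.KI t).H →L[ℝ] (hF.KI s).H} (h : IsTransitionFamily hF Ft Φ)
    (h' : IsTransitionFamily hF Ft Φ') : Φ = Φ' := by
  funext s t
  exact (hF.KI t).clm_ext fun u => RKHS.ext fun w => by rw [h s t u w, h' s t u w]

theorem inner_gen_apply (h : IsTransitionFamily hF Ft Φ) (s t : ℝ) (w u : Icc 0 a) :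
    ⟪hF.K.gen w, ((hF.translate s).adjoint ∘L Φ s t ∘L hF.translate t) (hF.K.gen u)⟫_ℝ
      = Ft (u + t - (w + s)) := by
  rw [ContinuousLinearMap.comp_apply, ContinuousLinearMap.comp_apply,
    ContinuousLinearMap.adjoint_inner_right, hF.translate_gen, hF.translate_gen,
    ReproducingKernel.inner_gen_left, h]

theorem translate_eq (h : IsTransitionFamily hF Ft Φ) (s t r : ℝ) :
    (hF.translate s).adjoint ∘L Φ s t ∘L hF.translate t =
      (hF.translate (s + r)).adjoint ∘L Φ (s + r) (t + r) ∘L hF.translate (t + r) := by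
  refine hF.K.clm_ext fun u => hF.K.eq_of_inner_gen fun w => ?_
  rw [h.inner_gen_apply, h.inner_gen_apply]
  congr 1
  ring

end IsTransitionFamily

namespace IsPosDefOn.Extends

variable {a : ℝ} {F : ℝ → ℝ} {Ft : ℝ → ℝ} {K : ReproducingKernel ℝ} (hK : Extends F a Ft K)
  {hF : IsPosDefOn a F}

include hK

theorem exists_isTransitionFamily (hF : IsPosDefOn a F) :
    ∃ Φ : ∀ s t : ℝ, (hF.KI t).H →L[ℝ] (hF.KI s).H,
      IsTransitionFamily hF Ft Φ ∧ ∀ s t, ‖Φ s t‖ ≤ 1 := by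
  have hJ := fun c : ℝ => hK.inner_gen_gen hF (c := c) (d := c + a) (by linarith)
  -- Embed the space of `I_t` in the space of `K`, then restrict to `I_s`.
  refine ⟨fun s t => ((hF.KI s).lift fun u => K.gen u).adjoint ∘L (hF.KI t).lift fun u => K.gen u,
    fun s t u w => ?_, fun s t => opNorm_comp_le_one ?_ ?_⟩
  · rw [← ReproducingKernel.inner_gen_left, ContinuousLinearMap.comp_apply,
      ReproducingKernel.inner_gen_adjoint_lift _ (hJ s), ReproducingKernel.lift_gen _ _ (hJ t),
      K.inner_gen_gen, K.symm', hK.apply_eq]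
  · rw [LinearIsometryEquiv.norm_map]
    exact (hF.KI s).norm_lift_le_one (hJ s)
  · exact (hF.KI t).norm_lift_le_one (hJ t)

/-- Only the difference of the two shifts matters, by stationarity. The free `c` lets consecutive
factors of a product meet at the same interval. -/
theorem comp_eq_shift_comp_shift {Φ : ∀ s t : ℝ, (hF.KI t).H →L[ℝ] (hF.KI s).H}
    (h : IsTransitionFamily hF Ft Φ) (c s : ℝ) :
    (hF.translate s).adjoint ∘L Φ s 0 ∘L hF.translate 0
      = (shift hF K c).adjoint ∘L shift hF K (c - s) := by
  refine hF.K.clm_ext fun u => hF.K.eq_of_inner_gen fun w => ?_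
  rw [h.inner_gen_apply, ContinuousLinearMap.comp_apply, hK.inner_gen_shift_adjoint, hK.shift_gen,
    K.inner_gen_gen, K.symm', hK.apply_eq]
  congr 1
  ring

theorem comp_apply_gen {Φ : ∀ s t : ℝ, (hF.KI t).H →L[ℝ] (hF.KI s).H}
    (h : IsTransitionFamily hF Ft Φ) (s : ℝ≥0) (u : Icc 0 a) (hu : (s : ℝ) ≤ u) :
    ((hF.translate s).adjoint ∘L Φ s 0 ∘L hF.translate 0) (hF.K.gen u)
      = hF.K.gen ⟨u - s, by linarith, by linarith [u.2.2, s.coe_nonneg]⟩ := by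
  refine hF.K.eq_of_inner_gen fun w => ?_
  have hs := s.coe_nonneg
  rw [h.inner_gen_apply, hF.K.inner_gen_gen, hF.K.symm', kernelOn_apply, ← hK.eq_of_abs_le]
  · congr 1
    simp only
    ring
  · exact abs_le.mpr ⟨by simp only; linarith [w.2.2], by simp only; linarith [w.2.1, u.2.2]⟩

omit hK in
theorem norm_comp_le_one {Φ : ∀ s t : ℝ, (hF.KI t).H →L[ℝ] (hF.KI s).H}
    (hΦ : ∀ s t, ‖Φ s t‖ ≤ 1) (s : ℝ) :
    ‖(hF.translate s).adjoint ∘L Φ s 0 ∘L hF.translate 0‖ ≤ 1 := by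
  refine opNorm_comp_le_one ?_ (opNorm_comp_le_one (hΦ _ _) (hF.norm_translate_le_one _))
  rw [LinearIsometryEquiv.norm_map]
  exact hF.norm_translate_le_one _

theorem tendsto_comp_apply (ha : 0 < a) (hcont : ContinuousOn F (Icc (-a) a))
    {Φ : ∀ s t : ℝ, (hF.KI t).H →L[ℝ] (hF.KI s).H}
    (h : IsTransitionFamily hF Ft Φ) (hΦ : ∀ s t, ‖Φ s t‖ ≤ 1) (g : hF.K.H) :
    Tendsto (fun s : ℝ => ((hF.translate s).adjoint ∘L Φ s 0 ∘L hF.translate 0) g) (𝓝 0)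
      (𝓝 g) := by
  have hnorm := norm_comp_le_one (hF := hF) hΦ
  refine tendsto_clm_apply_of_dense hnorm hF.K.denseRange_gen ?_ g
  have hgen : ∀ u, Tendsto (fun s : ℝ => ((hF.translate s).adjoint ∘L Φ s 0 ∘L hF.translate 0)
      (hF.K.gen u)) (𝓝 0) (𝓝 (hF.K.gen u)) := fun u => by
    rw [tendsto_iff_norm_sub_tendsto_zero]
    -- For a contraction, `‖Φ_s k_u - k_u‖² ≤ 2‖k_u‖² - 2⟨k_u, Φ_s k_u⟩ = 2 Ft 0 - 2 Ft s`.
    refine squeeze_zero (fun _ => norm_nonneg _) (fun s => ?_) (hK.tendsto_sqrt ha hcont)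
    have h1 := norm_clm_apply_le (hnorm s) (hF.K.gen u)
    have h2 : ‖hF.K.gen u‖ ^ 2 = Ft 0 := by
      rw [← real_inner_self_eq_norm_sq, hF.K.inner_gen_gen, kernelOn_apply, sub_self,
        hK.eq_of_abs_le 0 (by simpa using ha.le)]
    have h3 := h.inner_gen_apply s 0 u u
    rw [add_zero, sub_add_cancel_left, hK.even] at h3
    refine Real.le_sqrt_of_sq_le ?_
    rw [norm_sub_sq_real, real_inner_comm, h3, h2]
    have h4 := pow_le_pow_left₀ (norm_nonneg _) h1 2
    rw [h2] at h4
    linarith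
  rintro _ ⟨c, rfl⟩
  simp only [Finsupp.linearCombination_apply, Finsupp.sum, map_sum, map_smul]
  exact tendsto_finsetSum _ fun u _ => (hgen u).const_smul _

theorem isContractionSemigroup (ha : 0 < a) (hcont : ContinuousOn F (Icc (-a) a))
    (hM : ∀ x y, a < x → y < 0 → ⟪K.gen x, K.gen y⟫_ℝ
      = ⟪K.gen x, (closedSpan (K.gen '' Icc 0 a)).starProjection (K.gen y)⟫_ℝ)
    {Φ : ∀ s t : ℝ, (hF.KI t).H →L[ℝ] (hF.KI s).H}
    (h : IsTransitionFamily hF Ft Φ) (hΦ : ∀ s t, ‖Φ s t‖ ≤ 1) :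
    IsContractionSemigroup
      (fun s : ℝ≥0 => (hF.translate s).adjoint ∘L Φ s 0 ∘L hF.translate 0) where
  zero' := by
    refine hF.K.clm_ext fun u => ?_
    simpa using hK.comp_apply_gen h 0 u (by simpa using u.2.1)
  add' s t := by
    refine hF.K.clm_ext fun u => hF.K.eq_of_inner_gen fun w => ?_
    -- With `c = s` in the left factor and `c = 0` in the right one, the middle of the product is
    -- the projection onto the span of `[0, a]`.
    rw [h.inner_gen_apply, hK.comp_eq_shift_comp_shift h s s,
      hK.comp_eq_shift_comp_shift h 0 t, sub_self, zero_sub]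
    simp only [ContinuousLinearMap.comp_apply]
    rw [hK.inner_gen_shift_adjoint, ← ContinuousLinearMap.adjoint_inner_left,
      hK.inner_shift_adjoint, hK.shift_gen, zero_add]
    have hFt : Ft (u + 0 - (w + ↑(s + t))) = ⟪K.gen (w + s), K.gen (u + -t)⟫_ℝ := by
      rw [K.inner_gen_gen, K.symm', hK.apply_eq]
      congr 1
      push_cast
      ring
    rw [hFt]
    have hs := s.coe_nonneg
    have ht := t.coe_nonneg
    -- If `[0, a]` lies strictly between the two points, the Markov property removes the projection;
    -- otherwise one of them is in `[0, a]` and its generator is fixed.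
    rcases lt_or_ge (u + -t : ℝ) 0 with hu | hu
    · rcases lt_or_ge a (w + s : ℝ) with hw | hw
      · exact hM _ _ hw hu
      · rw [← Submodule.inner_starProjection_left_eq_right, Submodule.starProjection_eq_self_iff.mpr]
        exact subset_closedSpan _ ⟨_, ⟨by linarith [w.2.1], hw⟩, rfl⟩
    · rw [Submodule.starProjection_eq_self_iff.mpr]
      exact subset_closedSpan _ ⟨_, ⟨hu, by linarith [u.2.2]⟩, rfl⟩
  contraction' t := norm_comp_le_one hΦ _
  tendsto' g := by
    have h1 := tendsto_iff_norm_sub_tendsto_zero.mp (hK.tendsto_comp_apply ha hcont h hΦ g)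
    exact h1.comp ((NNReal.continuous_coe.tendsto' 0 0 NNReal.coe_zero).mono_left
      nhdsWithin_le_nhds)

end IsPosDefOn.Extends

/-! ### The positive-definite kernel of a contraction semigroup -/

/-- Expanding, `‖A^* A v - v‖² ≤ ‖v‖² - 2‖A v‖² + ‖v‖² = 0`. -/
theorem ContinuousLinearMap.adjoint_apply_apply_of_norm_eq {E G : Type*} [NormedAddCommGroup E]
    [InnerProductSpace ℝ E] [CompleteSpace E] [NormedAddCommGroup G] [InnerProductSpace ℝ G]
    [CompleteSpace G] {A : E →L[ℝ] G} (hA : ‖A‖ ≤ 1) {v : E} (hv : ‖A v‖ = ‖v‖) :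
    A.adjoint (A v) = v := by
  have h1 : ‖A.adjoint (A v)‖ ≤ ‖v‖ :=
    (norm_clm_apply_le (by rwa [LinearIsometryEquiv.norm_map]) _).trans_eq hv
  have h2 : ⟪A.adjoint (A v), v⟫_ℝ = ‖v‖ ^ 2 := by
    rw [ContinuousLinearMap.adjoint_inner_left, real_inner_self_eq_norm_sq, hv]
  rw [← sub_eq_zero, ← norm_eq_zero, ← sq_eq_zero_iff]
  refine le_antisymm ?_ (sq_nonneg _)
  rw [norm_sub_sq_real, h2]
  have h3 := pow_le_pow_left₀ (norm_nonneg _) h1 2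
  linarith

namespace IsContractionSemigroup

variable {E : Type*} [NormedAddCommGroup E] [InnerProductSpace ℝ E] {Φ : ℝ≥0 → E →L[ℝ] E}
  (h : IsContractionSemigroup Φ)

include h

theorem add_apply (s t : ℝ≥0) (v : E) : Φ (s + t) v = Φ s (Φ t v) := by
  rw [h.add', ContinuousLinearMap.comp_apply]

/-- Add the points in increasing order. If `x i` is the largest, the sum is `Φ_{M - x i} (α i • k +
w)`, where `w` is the sum over the other points with `x i` in place of `M`. Drop the contraction and
expand the square: the induction hypothesis bounds `‖w‖²`, and the remaining terms are exactly the
new ones of the quadratic form. -/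
theorem norm_sq_sum_le {ι : Type*} (k : E) (α x : ι → ℝ) (s : Finset ι) (M : ℝ)
    (hM : ∀ i ∈ s, x i ≤ M) :
    ‖∑ i ∈ s, α i • Φ (Real.nnabs (M - x i)) k‖ ^ 2
      ≤ ∑ i ∈ s, ∑ j ∈ s, α i * α j * ⟪k, Φ (Real.nnabs (x i - x j)) k⟫_ℝ := by
  classical
  induction s using Finset.induction_on_max_value x generalizing M with
  | empty => simp
  | insert i s hi hmax ih =>
    have hiM := hM i (Finset.mem_insert_self _ _)
    set w := ∑ j ∈ s, α j • Φ (Real.nnabs (x i - x j)) k with hw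
    have hshift : ∑ j ∈ insert i s, α j • Φ (Real.nnabs (M - x j)) k
        = Φ (Real.nnabs (M - x i)) (α i • k + w) := by
      rw [Finset.sum_insert hi, map_add, map_smul, hw, map_sum]
      congr 1
      refine Finset.sum_congr rfl fun j hj => ?_
      rw [map_smul, ← h.add_apply]
      congr 3
      have hj := hmax j hj
      ext
      rw [NNReal.coe_add, Real.coe_nnabs, Real.coe_nnabs, Real.coe_nnabs, abs_of_nonneg (by linarith),
        abs_of_nonneg (by linarith), abs_of_nonneg (by linarith)]
      ring
    have hsymm : ∀ j, ⟪k, Φ (Real.nnabs (x j - x i)) k⟫_ℝ = ⟪k, Φ (Real.nnabs (x i - x j)) k⟫_ℝ :=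
      fun j => by
        rw [show Real.nnabs (x j - x i) = Real.nnabs (x i - x j) from
          NNReal.coe_injective (by simp [abs_sub_comm])]
    have hcross : ⟪k, w⟫_ℝ = ∑ j ∈ s, α j * ⟪k, Φ (Real.nnabs (x i - x j)) k⟫_ℝ := by
      rw [hw, inner_sum]
      simp only [real_inner_smul_right]
    have hexp : ∑ j ∈ insert i s, ∑ l ∈ insert i s,
          α j * α l * ⟪k, Φ (Real.nnabs (x j - x l)) k⟫_ℝ
        = α i ^ 2 * ‖k‖ ^ 2 + 2 * α i * ⟪k, w⟫_ℝ
          + ∑ j ∈ s, ∑ l ∈ s, α j * α l * ⟪k, Φ (Real.nnabs (x j - x l)) k⟫_ℝ := by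
      simp only [Finset.sum_insert hi, Finset.sum_add_distrib, hsymm, sub_self, map_zero, h.zero',
        ContinuousLinearMap.id_apply, real_inner_self_eq_norm_sq]
      rw [hcross, Finset.mul_sum]
      have e1 : ∑ j ∈ s, α i * α j * ⟪k, Φ (Real.nnabs (x i - x j)) k⟫_ℝ
          + ∑ j ∈ s, α j * α i * ⟪k, Φ (Real.nnabs (x i - x j)) k⟫_ℝ
          = ∑ j ∈ s, 2 * α i * (α j * ⟪k, Φ (Real.nnabs (x i - x j)) k⟫_ℝ) := by
        rw [← Finset.sum_add_distrib]
        exact Finset.sum_congr rfl fun j _ => by ring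
      rw [← e1]
      ring
    have h1 := pow_le_pow_left₀ (norm_nonneg _)
      (norm_clm_apply_le (h.contraction' (Real.nnabs (M - x i))) (α i • k + w)) 2
    have h2 := ih (x i) hmax
    rw [hshift, hexp]
    refine h1.trans ?_
    rw [norm_add_sq_real, real_inner_smul_left, norm_smul, mul_pow, Real.norm_eq_abs, sq_abs]
    linarith

/-- The kernel `⟨k, Φ_{|x - y|} k⟩` attached to a contraction semigroup and a vector. -/
noncomputable def kernel (k : E) : ReproducingKernel ℝ where
  toFun x y := ⟪k, Φ (Real.nnabs (x - y)) k⟫_ℝ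
  symm' x y := by
    rw [show Real.nnabs (x - y) = Real.nnabs (y - x) from
      NNReal.coe_injective (by simp [abs_sub_comm])]
  nonneg' n α x := by
    obtain ⟨M, hM⟩ := (Finset.univ.image x).bddAbove
    exact (sq_nonneg _).trans (h.norm_sq_sum_le k α x Finset.univ M fun i _ => hM (by simp))

end IsContractionSemigroup

/-! ### From a canonical semigroup to its extension -/

namespace IsCanonicalSemigroup

open IsPosDefOn

variable {a : ℝ} {F : ℝ → ℝ} {hF : IsPosDefOn a F} {Φ : ℝ≥0 → hF.K.H →L[ℝ] hF.K.H}

/-- The function `⟨k_0, Φ_{|t|} k_0⟩` attached to a family of operators. -/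
noncomputable abbrev extension (ha : 0 < a) (Φ : ℝ≥0 → hF.K.H →L[ℝ] hF.K.H) (t : ℝ) : ℝ :=
  ⟪hF.K.gen ⟨0, le_rfl, ha.le⟩, Φ (Real.nnabs t) (hF.K.gen ⟨0, le_rfl, ha.le⟩)⟫_ℝ

variable (h : IsCanonicalSemigroup hF Φ) (ha : 0 < a)

include h

theorem apply_gen_self (s : ℝ≥0) (hs : (s : ℝ) ≤ a) :
    Φ s (hF.K.gen ⟨s, s.2, hs⟩) = hF.K.gen ⟨0, le_rfl, ha.le⟩ := by
  rw [h.2 s ⟨s, s.2, hs⟩ le_rfl]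
  simp

/-- Both `k_s` and `k_0` have squared norm `F 0`, so `Φ_s` preserves the norm of `k_s` and its
adjoint undoes it there. -/
theorem adjoint_apply_gen_zero (s : ℝ≥0) (hs : (s : ℝ) ≤ a) :
    (Φ s).adjoint (hF.K.gen ⟨0, le_rfl, ha.le⟩) = hF.K.gen ⟨s, s.2, hs⟩ := by
  rw [← h.apply_gen_self ha s hs]
  refine ContinuousLinearMap.adjoint_apply_apply_of_norm_eq (h.1.contraction' s) ?_
  rw [h.apply_gen_self ha s hs, ← sq_eq_sq₀ (norm_nonneg _) (norm_nonneg _),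
    ← real_inner_self_eq_norm_sq, ← real_inner_self_eq_norm_sq, hF.K.inner_gen_gen,
    hF.K.inner_gen_gen]
  simp [kernelOn_apply]

theorem inner_gen_eq (s : ℝ≥0) (w : Icc 0 a) (hs : (s : ℝ) = w) (v : hF.K.H) :
    ⟪hF.K.gen w, v⟫_ℝ = ⟪hF.K.gen ⟨0, le_rfl, ha.le⟩, Φ s v⟫_ℝ := by
  rw [← ContinuousLinearMap.adjoint_inner_left,
    h.adjoint_apply_gen_zero ha s (hs.trans_le w.2.2)]
  congr 2
  exact Subtype.ext hs.symm

theorem extension_eq (t : ℝ) (ht : |t| ≤ a) : extension ha Φ t = F t := by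
  have h1 : (Real.nnabs t : ℝ) = |t| := Real.coe_nnabs t
  rw [extension, ← ContinuousLinearMap.adjoint_inner_left,
    h.adjoint_apply_gen_zero ha _ (h1 ▸ ht), hF.K.inner_gen_gen, kernelOn_apply]
  simp only [h1, sub_zero]
  rcases abs_choice t with h2 | h2 <;> rw [h2]
  exact hF.even' t ht

theorem extends_kernel : Extends F a (extension ha Φ) (h.1.kernel (hF.K.gen ⟨0, le_rfl, ha.le⟩)) where
  apply_eq _ _ := rfl
  eq_of_abs_le := h.extension_eq ha

/-- For `t ≤ u` the semigroup translates `k_u` within `[0, a]`. For `t ≥ u`, time `u` is spent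
bringing `k_u` to `k_0`, and `k_w = Φ_w^* k_0` adds time `w`, leaving `⟨k_0, Φ_{w + t - u} k_0⟩`. -/
theorem inner_gen_apply_gen (t : ℝ≥0) (w u : Icc 0 a) :
    ⟪hF.K.gen w, Φ t (hF.K.gen u)⟫_ℝ = extension ha Φ (u - w - t) := by
  have ht := t.coe_nonneg
  rcases le_total (t : ℝ) u with htu | htu
  · rw [h.2 t u htu, hF.K.inner_gen_gen, hF.K.symm', kernelOn_apply, h.extension_eq ha]
    · congr 1
      simp only
      ring
    · exact abs_le.mpr ⟨by linarith [w.2.2], by linarith [w.2.1, u.2.2]⟩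
  · obtain ⟨v, hv⟩ : ∃ v : ℝ≥0, (v : ℝ) = u := ⟨⟨u, u.2.1⟩, rfl⟩
    obtain ⟨r, rfl⟩ : ∃ r, t = r + v :=
      ⟨t - v, (tsub_add_cancel_of_le (NNReal.coe_le_coe.mp (hv.trans_le htu))).symm⟩
    have e2 : Φ v (hF.K.gen u) = hF.K.gen ⟨0, le_rfl, ha.le⟩ := by
      rw [← h.apply_gen_self ha v (hv.trans_le u.2.2)]
      congr 2
      exact Subtype.ext hv.symm
    obtain ⟨z, hz⟩ : ∃ z : ℝ≥0, (z : ℝ) = w := ⟨⟨w, w.2.1⟩, rfl⟩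
    rw [h.1.add_apply, e2, h.inner_gen_eq ha z w hz, ← h.1.add_apply, extension]
    congr 3
    ext
    push_cast at htu ⊢
    rw [abs_of_nonpos (by linarith [w.2.1]), ← hv, ← hz]
    ring

/-- Seen from `[c, c + a]`, a generator to the left is `k_0` moved by the semigroup;
`shift_adjoint_gen_add` is the counterpart on the right, with `k_a` and the adjoint semigroup. -/
theorem shift_adjoint_gen_sub (c : ℝ) (r : ℝ≥0) :
    (Extends.shift hF (h.1.kernel (hF.K.gen ⟨0, le_rfl, ha.le⟩)) c).adjoint
        ((h.1.kernel (hF.K.gen ⟨0, le_rfl, ha.le⟩)).gen (c - r))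
      = Φ r (hF.K.gen ⟨0, le_rfl, ha.le⟩) := by
  refine hF.K.eq_of_inner_gen fun w => ?_
  rw [(h.extends_kernel ha).inner_gen_shift_adjoint, ReproducingKernel.inner_gen_gen,
    (h.extends_kernel ha).apply_eq, h.inner_gen_apply_gen ha, ← (h.extends_kernel ha).even]
  congr 1
  ring

theorem shift_adjoint_gen_add (c : ℝ) (s : ℝ≥0) :
    (Extends.shift hF (h.1.kernel (hF.K.gen ⟨0, le_rfl, ha.le⟩)) c).adjoint
        ((h.1.kernel (hF.K.gen ⟨0, le_rfl, ha.le⟩)).gen (c + a + s))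
      = (Φ s).adjoint (hF.K.gen ⟨a, ha.le, le_rfl⟩) := by
  refine hF.K.eq_of_inner_gen fun w => ?_
  rw [(h.extends_kernel ha).inner_gen_shift_adjoint, ReproducingKernel.inner_gen_gen,
    (h.extends_kernel ha).apply_eq, ContinuousLinearMap.adjoint_inner_right, real_inner_comm,
    h.inner_gen_apply_gen ha]
  congr 1
  ring

theorem isCanonicalExtension (hcont : ContinuousOn F (Icc (-a) a)) :
    IsCanonicalExtension a F (extension ha Φ) := by
  refine (h.extends_kernel ha).isCanonicalExtension ha hcont fun c u hu v hv => ?_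
  obtain ⟨r, rfl⟩ : ∃ r : ℝ≥0, u = c - r := ⟨⟨c - u, sub_nonneg.mpr hu⟩, (sub_sub_cancel c u).symm⟩
  obtain ⟨s, rfl⟩ : ∃ s : ℝ≥0, v = c + a + s := ⟨⟨v - (c + a), sub_nonneg.mpr hv⟩, (add_sub_cancel (c + a) v).symm⟩
  -- The projected inner product is `⟨Φ_r k_0, Φ_s^* k_a⟩ = ⟨Φ_{s+r} k_0, k_a⟩`, so the semigroup
  -- law is what gives the Markov property.
  rw [← (h.extends_kernel ha).inner_shift_adjoint hF, h.shift_adjoint_gen_sub ha,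
    h.shift_adjoint_gen_add ha, ContinuousLinearMap.adjoint_inner_right, ← h.1.add_apply,
    real_inner_comm (hF.K.gen _), h.inner_gen_apply_gen ha, ReproducingKernel.inner_gen_gen,
    (h.extends_kernel ha).apply_eq]
  congr 1
  push_cast
  ring

theorem eq_of_extension_eq {Φ' : ℝ≥0 → hF.K.H →L[ℝ] hF.K.H} (h' : IsCanonicalSemigroup hF Φ')
    (he : extension ha Φ = extension ha Φ') : Φ = Φ' := by
  funext t
  refine hF.K.clm_ext fun u => hF.K.eq_of_inner_gen fun w => ?_
  rw [h.inner_gen_apply_gen ha, h'.inner_gen_apply_gen ha, he]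

end IsCanonicalSemigroup

/-! ### The correspondence -/

namespace IsCanonicalExtension

open IsPosDefOn

variable {a : ℝ} {F : ℝ → ℝ} {Ft : ℝ → ℝ}

theorem exists_extends (h : IsCanonicalExtension a F Ft) :
    ∃ K, Extends F a Ft K ∧ ∀ x y, a < x → y < 0 → ⟪K.gen x, K.gen y⟫_ℝ
      = ⟪K.gen x, (closedSpan (K.gen '' Icc 0 a)).starProjection (K.gen y)⟫_ℝ := by
  obtain ⟨K, hK, hcompl, hcan⟩ := h
  refine ⟨K, ⟨hK, fun t ht => ?_⟩, fun x y hx hy => ?_⟩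
  · have := hcompl t 0 (mem_band.mpr (by simpa using ht))
    simpa [hK] using this
  · have hsep : Separates (band a) (Icc 0 a) x y := by
      simpa using separates_band_Icc (c := 0) (by simpa using hx) hy
    rw [K.inner_gen_gen, ← K.inner_genOn, hcan _ _ _ hsep]

theorem isCanonicalSemigroup (h : IsCanonicalExtension a F Ft) (ha : 0 < a)
    (hcont : ContinuousOn F (Icc (-a) a)) {hF : IsPosDefOn a F}
    {Φ : ∀ s t : ℝ, (hF.KI t).H →L[ℝ] (hF.KI s).H} (hΦ : IsTransitionFamily hF Ft Φ)
    (hn : ∀ s t, ‖Φ s t‖ ≤ 1) :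
    IsCanonicalSemigroup hF
      (fun s : ℝ≥0 => (hF.translate s).adjoint ∘L Φ s 0 ∘L hF.translate 0) := by
  obtain ⟨K, hK, hM⟩ := h.exists_extends
  exact ⟨hK.isContractionSemigroup ha hcont hM hΦ hn, hK.comp_apply_gen hΦ⟩

theorem extension_eq (h : IsCanonicalExtension a F Ft) (ha : 0 < a) {hF : IsPosDefOn a F}
    {Φ : ∀ s t : ℝ, (hF.KI t).H →L[ℝ] (hF.KI s).H} (hΦ : IsTransitionFamily hF Ft Φ) (t : ℝ) :
    Ft t = IsCanonicalSemigroup.extension ha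
      (fun s : ℝ≥0 => (hF.translate s).adjoint ∘L Φ s 0 ∘L hF.translate 0) t := by
  obtain ⟨K, hK, -⟩ := h.exists_extends
  rw [IsCanonicalSemigroup.extension, hΦ.inner_gen_apply]
  simp only [add_zero, zero_add, zero_sub, hK.even, Real.coe_nnabs]
  rcases abs_choice t with h2 | h2 <;> rw [h2]
  exact (hK.even t).symm

end IsCanonicalExtension

theorem mainTheorem9 (a : ℝ) (ha : 0 < a) (F : ℝ → ℝ) (hF : IsPosDefOn a F)
    (hcont : ContinuousOn F (Set.Icc (-a) a)) :
    -- construction of the semigroup attached to a canonical extension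
    (∀ Ft : ℝ → ℝ, IsCanonicalExtension a F Ft →
      ∃! Φ : ∀ s t : ℝ, (hF.KI t).H →L[ℝ] (hF.KI s).H,
        IsTransitionFamily hF Ft Φ) ∧
    (∀ Ft : ℝ → ℝ, IsCanonicalExtension a F Ft →
      ∀ Φ : ∀ s t : ℝ, (hF.KI t).H →L[ℝ] (hF.KI s).H, IsTransitionFamily hF Ft Φ →
        (∀ s t : ℝ, ‖Φ s t‖ ≤ 1) ∧
        (∀ s t h : ℝ, t ≤ s →
          (hF.translate s).adjoint ∘L Φ s t ∘L hF.translate t =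
            (hF.translate (s + h)).adjoint ∘L Φ (s + h) (t + h) ∘L hF.translate (t + h)) ∧
        IsCanonicalSemigroup hF
          (fun s : ℝ≥0 => (hF.translate s).adjoint ∘L Φ s 0 ∘L hF.translate 0) ∧
        ∀ t : ℝ, Ft t =
          ⟪hF.K.gen ⟨0, le_rfl, ha.le⟩,
            ((hF.translate (Real.nnabs t)).adjoint ∘L Φ (Real.nnabs t) 0 ∘L hF.translate 0)
              (hF.K.gen ⟨0, le_rfl, ha.le⟩)⟫_ℝ) ∧
    -- the bijective correspondence
    Set.BijOn
      (fun (Φ : ℝ≥0 → hF.K.H →L[ℝ] hF.K.H) (t : ℝ) =>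
        ⟪hF.K.gen ⟨0, le_rfl, ha.le⟩, Φ (Real.nnabs t) (hF.K.gen ⟨0, le_rfl, ha.le⟩)⟫_ℝ)
      {Φ | IsCanonicalSemigroup hF Φ}
      {Ft | IsCanonicalExtension a F Ft} := by 
  refine ⟨fun Ft hFt => ?_, fun Ft hFt Φ hΦ => ?_, fun Φ hΦ => ?_, fun Φ hΦ Φ' hΦ' he => ?_,
    fun Ft hFt => ?_⟩
  · obtain ⟨K, hK, -⟩ := hFt.exists_extends
    obtain ⟨Φ, hΦ, -⟩ := hK.exists_isTransitionFamily hF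
    exact ⟨Φ, hΦ, fun Φ' hΦ' => hΦ'.unique hΦ⟩
  · obtain ⟨K, hK, -⟩ := hFt.exists_extends
    obtain ⟨Φ', hΦ', hn⟩ := hK.exists_isTransitionFamily hF
    -- Uniqueness passes the norm bound of the constructed family to the given one.
    obtain rfl := hΦ.unique hΦ'
    exact ⟨hn, fun s t r _ => hΦ.translate_eq s t r,
      hFt.isCanonicalSemigroup ha hcont hΦ hn, hFt.extension_eq ha hΦ⟩
  · exact IsCanonicalSemigroup.isCanonicalExtension hΦ ha hcont
  · exact IsCanonicalSemigroup.eq_of_extension_eq hΦ ha hΦ' he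
  · obtain ⟨K, hK, -⟩ := hFt.exists_extends
    obtain ⟨Φ, hΦ, hn⟩ := hK.exists_isTransitionFamily hF
    exact ⟨_, hFt.isCanonicalSemigroup ha hcont hΦ hn,
      funext fun t => (hFt.extension_eq ha hΦ t).symm⟩
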